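/- Let $X=[0,1]$ and $Z=[0,1]^2$ carry Lebesgue measure $m$, and let $\pi:Z\to X$ be the projection onto the first coordinate. For $\Omega\in\{X,Z\}$ let $\mathcal G(\Omega)$ be the set of invertible measure-preserving transformations of $\Omega$, where two transformations are identified if they agree almost everywhere. Equip $\mathcal G(Z)$ with the weak topology, that is, the topology with subbasis $$N_\epsilon(T;E)=\{S\in\mathcal G(Z): m(TE\,\triangle\, SE)<\epsilon\},\qquad T\in\mathcal G(Z),\ \epsilon>0,\ E\subset Z\text{ measurable}.$$ Say that $T\in\mathcal G(Z)$ extends $T'\in\mathcal G(X)$ if $\pi\circ T=T'\circ\pi$ almost everywhere, and let $\mathcal G_X\subset\mathcal G(Z)$ be the set of all $T$ that extend some $T'\in\mathcal G(X)$ (such a $T'$ is then unique), with the subspace topology. Let $\mathbb E(\cdot|X)$ denote conditional expectation with respect to the $\sigma$-algebra of sets $\pi^{-1}(A)$, $A\subset X$ measurable, regarded as a function on $X$, and let $L^2(Z|X)$ be the set of $f\in L^2(Z)$ (complex valued) with $\mathbb E(|f|^2|X)^{1/2}\in L^\infty(X)$. Write $T^nf=f\circ T^n$ and $(T')^nh=h\circ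 (T')^n$. An extension $T\in\mathcal G_X$ of $T'$ is strongly mixing if for all $f,g\in L^2(Z|X)$ $$\lim_{n\to\infty}\big\|\mathbb E(T^nf\,\overline g\,|X)-(T')^n\mathbb E(f|X)\;\mathbb E(\overline g|X)\big\|_{L^2(X)}=0 .$$ Let $\mathcal S_X\subset\mathcal G_X$ be the set of strongly mixing extensions. **Theorem (Strongly Mixing Extensions are of First Category).** $\mathcal S_X$ is of first category (meagre) in $\mathcal G_X$. -/

import Mathlib

open MeasureTheory Filter Topology Set
open scoped ENNReal symmDiff

noncomputable section

namespace MixExt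

/-! ### Invertible measure-preserving transformations modulo null sets -/

/-- An invertible measure-preserving transformation of a measure space (everywhere defined). -/
structure MPEquiv (α : Type*) [MeasureSpace α] where
  toEquiv : α ≃ᵐ α
  measurePreserving : MeasurePreserving toEquiv volume volume

instance {α : Type*} [MeasureSpace α] : CoeFun (MPEquiv α) (fun _ => α → α) :=
  ⟨fun e => e.toEquiv⟩

/-- Two transformations are identified if they differ on a set of measure zero. -/
instance MPEquiv.setoid (α : Type*) [MeasureSpace α] : Setoid (MPEquiv α) where
  r S T := ∀ᵐ z : α, S z = T z
  iseqv :=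
    { refl := fun _ => Eventually.of_forall fun _ => rfl
      symm := fun h => h.mono fun _ hz => hz.symm
      trans := fun h₁ h₂ => by filter_upwards [h₁, h₂] with z a b using a.trans b }

/-- The set `𝒢(α)` of invertible measure-preserving transformations of `α`, modulo almost
everywhere equality. -/
def Transf (α : Type*) [MeasureSpace α] : Type _ := Quotient (MPEquiv.setoid α)

/-- `μ(SE ∆ TE)` for everywhere defined transformations. -/
def imageDist₀ {α : Type*} [MeasureSpace α] (E : Set α) (S T : MPEquiv α) : ℝ≥0∞ :=
  volume ((S '' E) ∆ (T '' E))

theorem image_ae_eq {α : Type*} [MeasureSpace α] (E : Set α) {S T : MPEquiv α}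
    (h : S ≈ T) : (S '' E : Set α) =ᵐ[volume] (T '' E : Set α) := by
  have h0 : volume {z : α | ¬ S z = T z} = 0 := h
  have key : ∀ U : MPEquiv α, volume (U '' {z : α | ¬ S z = T z}) = 0 := by
    intro U
    have h1 : volume (U ⁻¹' (U '' {z : α | ¬ S z = T z})) = 0 := by
      rw [preimage_image_eq _ U.toEquiv.injective]; exact h0
    rwa [U.measurePreserving.measure_preimage_equiv] at h1
  refine eventuallyLE_antisymm_iff.2 ⟨?_, ?_⟩ <;> rw [ae_le_set]
  · refine measure_mono_null ?_ (key S)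
    rintro _ ⟨⟨z, hz, rfl⟩, hn⟩
    exact ⟨z, fun he => hn ⟨z, hz, he.symm⟩, rfl⟩
  · refine measure_mono_null ?_ (key T)
    rintro _ ⟨⟨z, hz, rfl⟩, hn⟩
    exact ⟨z, fun he => hn ⟨z, hz, he⟩, rfl⟩

/-- `μ(SE ∆ TE)` for transformations modulo null sets. -/
def imageDist {α : Type*} [MeasureSpace α] (E : Set α) (S T : Transf α) : ℝ≥0∞ :=
  Quotient.liftOn₂ S T (imageDist₀ E) fun _ _ _ _ hS hT =>
    measure_congr ((image_ae_eq E hS).symmDiff (image_ae_eq E hT))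

/-- The weak topology on `𝒢(α)`: the sets `N_ε(T;E) = {S | μ(TE ∆ SE) < ε}`, for `ε > 0` and
`E` measurable, form a subbasis. -/
instance Transf.weakTopology (α : Type*) [MeasureSpace α] : TopologicalSpace (Transf α) :=
  TopologicalSpace.generateFrom
    {N | ∃ (T : Transf α) (E : Set α) (ε : ℝ), MeasurableSet E ∧ 0 < ε ∧
      N = {S : Transf α | imageDist E T S < ENNReal.ofReal ε}}

/-! ### Extensions on the unit square -/

/-- The unit interval with Lebesgue measure. -/
abbrev X : Type := unitInterval

/-- The unit square with Lebesgue measure; the factor map onto `X` is `Prod.fst`. -/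
abbrev Z : Type := X × X

/-- `T` is an extension of `T'`: `π ∘ T = T' ∘ π` almost everywhere. -/
def Extends₀ (T : MPEquiv Z) (T' : MPEquiv X) : Prop :=
  ∀ᵐ z : Z, (T z).1 = T' z.1

theorem extends₀_of_equiv {S T : MPEquiv Z} {S' T' : MPEquiv X} (h : S ≈ T) (h' : S' ≈ T')
    (hS : Extends₀ S S') : Extends₀ T T' := by
  have h1 : ∀ᵐ z : Z, S z = T z := h
  have h2 : ∀ᵐ z : Z, S' z.1 = T' z.1 :=
    Measure.quasiMeasurePreserving_fst.ae (μa := (volume : Measure Z)) h'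
  have h3 : ∀ᵐ z : Z, (S z).1 = S' z.1 := hS
  show ∀ᵐ z : Z, (T z).1 = T' z.1
  filter_upwards [h1, h2, h3] with z a b c
  rw [← a, ← b, c]

/-- `T` is an extension of `T'`, for transformations modulo null sets. -/
def Extends (T : Transf Z) (T' : Transf X) : Prop :=
  Quotient.liftOn₂ T T' Extends₀ fun _ _ _ _ h h' =>
    propext ⟨extends₀_of_equiv h h', extends₀_of_equiv (Setoid.symm h) (Setoid.symm h')⟩

/-- `𝒢_X`, the set of all `T ∈ 𝒢(Z)` that extend some `T' ∈ 𝒢(X)`; as a type it carries the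
subspace topology of the weak topology. -/
def GX : Set (Transf Z) := {T | ∃ T' : Transf X, Extends T T'}

/-! ### Conditional expectation on the factor and the module `L²(Z|X)` -/

/-- The conditional expectation `𝔼(f|X)`, as a function on the factor `X`. -/
def relExp {E : Type*} [NormedAddCommGroup E] [NormedSpace ℝ E] (f : Z → E) (x : X) : E :=
  ∫ y : X, f (x, y)

/-- `𝔼(f|X) ∘ π` is the conditional expectation of `f` with respect to the `σ`-algebra of all
`π⁻¹(A)`, `A ⊆ X` measurable. -/
theorem relExp_comp_fst {E : Type*} [NormedAddCommGroup E] [NormedSpace ℝ E] [CompleteSpace E]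
    {f : Z → E} (hf : Integrable f) :
    (fun z : Z => relExp f z.1) =ᵐ[volume]
      (volume : Measure Z)[f | MeasurableSpace.comap Prod.fst inferInstance] := by
  have hm : MeasurableSpace.comap (Prod.fst : Z → X) inferInstance ≤
      (inferInstance : MeasurableSpace Z) := measurable_fst.comap_le
  have hr : Integrable (relExp f) := hf.integral_prod_left
  have hri : Integrable (fun z : Z => relExp f z.1) := hr.comp_fst (volume : Measure X)
  refine ae_eq_condExp_of_forall_setIntegral_eq hm hf (fun s _ _ => hri.integrableOn) ?_ ?_
  · rintro _ ⟨A, hA, rfl⟩ _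
    have e : (Prod.fst ⁻¹' A : Set Z) = A ×ˢ univ := by ext; simp
    rw [e, Measure.volume_eq_prod, setIntegral_prod _ hri.integrableOn,
      setIntegral_prod _ hf.integrableOn]
    simp [relExp]
  · have h1 : AEStronglyMeasurable (relExp f) ((volume : Measure Z).map Prod.fst) := by
      rw [Measure.volume_eq_prod,
        (measurePreserving_fst (μ := (volume : Measure X)) (ν := (volume : Measure X))).map_eq]
      exact hr.aestronglyMeasurable
    exact h1.comp_ae_measurable' measurable_fst.aemeasurable

/-- `f ∈ L²(Z|X)`: `f ∈ L²(Z)` and `𝔼(|f|²|X)^{1/2} ∈ L^∞(X)`. -/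
def MemRelL2 (f : Z → ℂ) : Prop :=
  MemLp f 2 volume ∧ MemLp (fun x : X => Real.sqrt (relExp (fun z => ‖f z‖ ^ 2) x)) ∞ volume

/-! ### Strongly mixing extensions -/

/-- `T` is strongly mixing relative to `T'`: for all `f, g ∈ L²(Z|X)`,
`‖𝔼(Tⁿf ḡ|X) - (T')ⁿ𝔼(f|X) 𝔼(ḡ|X)‖_{L²(X)} → 0`, where `T` and `T'` act on functions by
composition. -/
def StronglyMixing₀ (T : MPEquiv Z) (T' : MPEquiv X) : Prop :=
  ∀ f g : Z → ℂ, MemRelL2 f → MemRelL2 g →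
    Tendsto (fun n : ℕ => eLpNorm (fun x : X =>
        relExp (fun z => f (T^[n] z) * starRingEnd ℂ (g z)) x -
          relExp f (T'^[n] x) * relExp (fun z => starRingEnd ℂ (g z)) x) 2 volume)
      atTop (𝓝 0)

theorem iterate_ae_eq {α : Type*} [MeasureSpace α] {S T : MPEquiv α} (h : S ≈ T) (n : ℕ) :
    ∀ᵐ z : α, S^[n] z = T^[n] z := by
  induction n with
  | zero => exact Eventually.of_forall fun _ => rfl
  | succ n ih =>
    have h1 : ∀ᵐ z : α, S z = T z := h
    filter_upwards [h1, S.measurePreserving.quasiMeasurePreserving.ae ih] with z a b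
    rw [Function.iterate_succ_apply, Function.iterate_succ_apply, b, a]

theorem stronglyMixing₀_of_equiv {S T : MPEquiv Z} {S' T' : MPEquiv X} (h : S ≈ T)
    (h' : S' ≈ T') (hS : StronglyMixing₀ S S') : StronglyMixing₀ T T' := by
  intro f g hf hg
  refine (hS f g hf hg).congr fun n => eLpNorm_congr_ae ?_
  have h1 : ∀ᵐ x : X, ∀ᵐ y : X, S^[n] (x, y) = T^[n] (x, y) :=
    Measure.ae_ae_of_ae_prod (iterate_ae_eq h n)
  filter_upwards [h1, iterate_ae_eq h' n] with x a b
  have e : relExp (fun z => f (S^[n] z) * starRingEnd ℂ (g z)) x =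
      relExp (fun z => f (T^[n] z) * starRingEnd ℂ (g z)) x :=
    integral_congr_ae (a.mono fun y hy => by simp only [hy])
  rw [e, b]

/-- Strong mixing of `T` relative to `T'`, for transformations modulo null sets. -/
def StronglyMixing (T : Transf Z) (T' : Transf X) : Prop :=
  Quotient.liftOn₂ T T' StronglyMixing₀ fun _ _ _ _ h h' =>
    propext ⟨stronglyMixing₀_of_equiv h h',
      stronglyMixing₀_of_equiv (Setoid.symm h) (Setoid.symm h')⟩

/-- `𝒮_X`, the set of strongly mixing extensions, as a subset of the space `𝒢_X`. -/
def SX : Set GX := {T | ∃ T' : Transf X, Extends T T' ∧ StronglyMixing T T'}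

end MixExt

end

/-! Let `E = lowerHalf`, of measure 1/2 on every fibre. If `T` is strongly mixing over `X`,
integrating the mixing relation for `f = g = 1_E` gives `m(TⁿE ∩ E) → 1/4`, so this measure is
eventually at most 2/5. Hence `T` leaves `recurrentSet E (2/5) n` for some `n`
(`exists_notMem_recurrentSet_of_mem_SX`). These sets are open because iteration is weakly
continuous, and dense in `GX` because they contain every almost everywhere periodic extension: along
the times `m!` such a map returns almost all of `E` to itself. So the complement of `SX` is
residual.

The substance is the density of periodic extensions (`exists_periodic_near`), obtained even for the
uniform distance `m{S ≠ T}`. All modifications stay inside the orbits of `T`. `exists_closing` takes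
a set `W` of aperiodic points that is recurrent in both time directions, finds a marker set `B ⊆ W`
of measure at most `1/(N+1)`, and redirects the top of each column over `B` to its own base, so that
columns become cycles. This is done twice. First the factor map `T'` is made periodic, and the
exponents used there are lifted to `T`. Then, over a periodic factor, `W` lies over one point of
each `T'`-orbit: redirecting from `W` to `W` does not change the first coordinate, so the factor map
survives. -/

namespace MixExt

/-! ### The full group of a transformation -/

section FullGroup

variable {α : Type*} [MeasureSpace α]

/-- The permutation underlying an invertible measure-preserving transformation. -/
def MPEquiv.perm (T : MPEquiv α) : Equiv.Perm α := T.toEquiv.toEquiv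

theorem MPEquiv.perm_apply (T : MPEquiv α) (z : α) : T.perm z = T z := rfl

theorem MPEquiv.measurePreserving_zpow (T : MPEquiv α) (n : ℤ) :
    MeasurePreserving (T.perm ^ n : Equiv.Perm α) (volume : Measure α) volume := by
  have h1 : MeasurePreserving (T.perm : α → α) (volume : Measure α) volume := T.measurePreserving
  have h2 : MeasurePreserving (T.perm⁻¹ : Equiv.Perm α) (volume : Measure α) volume :=
    MeasurePreserving.symm T.toEquiv T.measurePreserving
  obtain ⟨m, rfl | rfl⟩ := n.eq_nat_or_neg
  · rw [zpow_natCast, ← Equiv.Perm.iterate_eq_pow]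
    exact h1.iterate m
  · rw [zpow_neg, zpow_natCast, ← inv_pow, ← Equiv.Perm.iterate_eq_pow]
    exact h2.iterate m

theorem MPEquiv.measurable_zpow (T : MPEquiv α) (n : ℤ) :
    Measurable (T.perm ^ n : Equiv.Perm α) :=
  (T.measurePreserving_zpow n).measurable

theorem MPEquiv.image_zpow (T : MPEquiv α) (n : ℤ) (E : Set α) :
    (T.perm ^ n : Equiv.Perm α) '' E = (T.perm ^ (-n) : Equiv.Perm α) ⁻¹' E := by
  rw [zpow_neg, Equiv.image_eq_preimage_symm]
  rfl

/-- A bijection that acts on each orbit of `T` by a measurable cocycle is an invertible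
measure-preserving transformation. -/
theorem exists_mpEquiv_of_zpow (T : MPEquiv α) {k : α → ℤ} (hk : Measurable k) {S : α → α}
    (hS : Function.Bijective S) (hSk : ∀ z, S z = (T.perm ^ k z) z) :
    ∃ S' : MPEquiv α, ∀ z, S' z = S z := by
  have hpre : ∀ E : Set α, S ⁻¹' E = ⋃ n : ℤ, (k ⁻¹' {n} ∩ (T.perm ^ n : Equiv.Perm α) ⁻¹' E) := by
    intro E
    ext z
    simp [hSk]
  have himg : ∀ E : Set α,
      S '' E = ⋃ n : ℤ, (T.perm ^ n : Equiv.Perm α) '' (k ⁻¹' {n} ∩ E) := by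
    intro E
    ext w
    simp only [mem_image, mem_iUnion, mem_inter_iff, mem_preimage, mem_singleton_iff]
    constructor
    · rintro ⟨z, hz, rfl⟩
      exact ⟨k z, z, ⟨rfl, hz⟩, (hSk z).symm⟩
    · rintro ⟨n, z, ⟨rfl, hz⟩, rfl⟩
      exact ⟨z, hz, hSk z⟩
  have hkm : ∀ n : ℤ, MeasurableSet (k ⁻¹' {n}) := fun n => hk (measurableSet_singleton n)
  have hm : Measurable S := fun E hE => by
    rw [hpre]
    exact MeasurableSet.iUnion fun n => (hkm n).inter (T.measurable_zpow n hE)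
  have hpiece : ∀ (n : ℤ) (E : Set α), MeasurableSet E →
      MeasurableSet ((T.perm ^ n : Equiv.Perm α) '' (k ⁻¹' {n} ∩ E)) := fun n E hE => by
    rw [T.image_zpow]
    exact T.measurable_zpow _ ((hkm n).inter hE)
  have hmi : ∀ E : Set α, MeasurableSet E → MeasurableSet (S '' E) := fun E hE => by
    rw [himg]
    exact MeasurableSet.iUnion fun n => hpiece n E hE
  have hvol : ∀ E : Set α, MeasurableSet E → volume (S '' E) = volume E := by
    intro E hE
    -- The pieces moved by different powers stay disjoint because `S` is injective; each power
    -- preserves measure, so the measures add up.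
    have hdisj : Pairwise (Function.onFun Disjoint
        fun n : ℤ => (T.perm ^ n : Equiv.Perm α) '' (k ⁻¹' {n} ∩ E)) := by
      intro m n hmn
      refine Set.disjoint_left.2 ?_
      rintro _ ⟨z, ⟨hz, -⟩, rfl⟩ ⟨w, ⟨hw, -⟩, hzw⟩
      rw [mem_preimage, mem_singleton_iff] at hz hw
      subst hz hw
      rw [← hSk, ← hSk] at hzw
      exact hmn (by rw [hS.1 hzw])
    have hdisj' : Pairwise (Function.onFun Disjoint fun n : ℤ => k ⁻¹' {n} ∩ E) := by
      intro m n hmn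
      refine Set.disjoint_left.2 ?_
      rintro z ⟨hz, -⟩ ⟨hw, -⟩
      exact hmn (hz.symm.trans hw)
    have hE' : E = ⋃ n : ℤ, k ⁻¹' {n} ∩ E := by
      ext z
      simp
    rw [himg, measure_iUnion hdisj fun n => hpiece n E hE]
    conv_rhs => rw [hE', measure_iUnion hdisj' fun n => (hkm n).inter hE]
    refine tsum_congr fun n => ?_
    rw [T.image_zpow, (T.measurePreserving_zpow (-n)).measure_preimage
      ((hkm n).inter hE).nullMeasurableSet]
  let e : α ≃ᵐ α :=
    { toEquiv := Equiv.ofBijective S hS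
      measurable_toFun := hm
      measurable_invFun := fun E hE => by
        have := hmi E hE
        rwa [show S '' E = (Equiv.ofBijective S hS).symm ⁻¹' E from
          (Equiv.ofBijective S hS).image_eq_preimage_symm E] at this }
  refine ⟨⟨e, hm, ?_⟩, fun z => rfl⟩
  ext E hE
  change Measure.map S volume E = volume E
  rw [Measure.map_apply hm hE]
  have := hvol (S ⁻¹' E) (hm hE)
  rwa [image_preimage_eq _ hS.2, eq_comm] at this

end FullGroup

/-! ### First return to a set -/

section Return

variable {α : Type*}

open Classical in
/-- The first positive time at which a point of `B` returns to `B` (and `0` off `B`). -/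
noncomputable def returnTime (f : Equiv.Perm α) (B : Set α)
    (h : ∀ w, ∃ n : ℕ, w ∉ B ∨ (1 ≤ n ∧ (f ^ n) w ∈ B)) (w : α) : ℕ :=
  Nat.find (h w)

variable {f : Equiv.Perm α} {B : Set α}

theorem returnTime_of_notMem (h : ∀ w, ∃ n : ℕ, w ∉ B ∨ (1 ≤ n ∧ (f ^ n) w ∈ B)) {w : α}
    (hw : w ∉ B) : returnTime f B h w = 0 := by
  classical
  exact (Nat.find_eq_zero (h w)).2 (Or.inl hw)

theorem returnTime_of_mem (h : ∀ w, ∃ n : ℕ, w ∉ B ∨ (1 ≤ n ∧ (f ^ n) w ∈ B)) {w : α}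
    (hw : w ∈ B) : 1 ≤ returnTime f B h w ∧ (f ^ returnTime f B h w) w ∈ B ∧
      ∀ m, 1 ≤ m → m < returnTime f B h w → (f ^ m) w ∉ B := by
  classical
  obtain h1 | h1 := Nat.find_spec (h w)
  · exact absurd hw h1
  · exact ⟨h1.1, h1.2, fun m hm hlt hB => Nat.find_min (h w) hlt (Or.inr ⟨hm, hB⟩)⟩

theorem returnTime_eq (h : ∀ w, ∃ n : ℕ, w ∉ B ∨ (1 ≤ n ∧ (f ^ n) w ∈ B)) {w : α} (hw : w ∈ B)
    {n : ℕ} (hn : 1 ≤ n) (hB : (f ^ n) w ∈ B) (hmin : ∀ m, 1 ≤ m → m < n → (f ^ m) w ∉ B) :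
    returnTime f B h w = n := by
  obtain ⟨h1, h2, h3⟩ := returnTime_of_mem h hw
  rcases lt_trichotomy (returnTime f B h w) n with hlt | heq | hgt
  · exact absurd h2 (hmin _ h1 hlt)
  · exact heq
  · exact absurd hB (h3 n hn hgt)

theorem pow_inv_pow_apply (f : Equiv.Perm α) {m n : ℕ} (hmn : m ≤ n) (w : α) :
    (f⁻¹ ^ m) ((f ^ n) w) = (f ^ (n - m)) w := by
  obtain ⟨k, rfl⟩ := Nat.exists_eq_add_of_le hmn
  rw [Nat.add_sub_cancel_left, pow_add, ← Equiv.Perm.mul_apply, inv_pow, inv_mul_cancel_left]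

/-- No visit to `B` occurs strictly between `w` and its first return, so looking backward from the
return point the first visit is `w` itself. This makes the first return map, extended by the
identity, a bijection. -/
theorem returnTime_inv (h : ∀ w, ∃ n : ℕ, w ∉ B ∨ (1 ≤ n ∧ (f ^ n) w ∈ B))
    (h' : ∀ w, ∃ n : ℕ, w ∉ B ∨ (1 ≤ n ∧ (f⁻¹ ^ n) w ∈ B)) (w : α) :
    (f⁻¹ ^ returnTime f⁻¹ B h' ((f ^ returnTime f B h w) w)) ((f ^ returnTime f B h w) w) = w := by
  by_cases hw : w ∈ B
  · obtain ⟨h1, h2, h3⟩ := returnTime_of_mem h hw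
    set r := returnTime f B h w with hr
    have e : returnTime f⁻¹ B h' ((f ^ r) w) = r := by
      refine returnTime_eq h' h2 h1 ?_ ?_
      · rw [pow_inv_pow_apply f le_rfl, Nat.sub_self, pow_zero]
        exact hw
      · intro m hm hmr
        rw [pow_inv_pow_apply f hmr.le]
        exact h3 _ (by omega) (by omega)
    rw [e, pow_inv_pow_apply f le_rfl, Nat.sub_self, pow_zero]
    rfl
  · rw [returnTime_of_notMem h hw, pow_zero, Equiv.Perm.one_apply, returnTime_of_notMem h' hw]
    rfl

/-- Composing `f` with the inverse of the first return map closes up every column over `B` to a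
cycle. -/
theorem periodic_of_returnTime (h : ∀ w, ∃ n : ℕ, w ∉ B ∨ (1 ≤ n ∧ (f ^ n) w ∈ B))
    (h' : ∀ w, ∃ n : ℕ, w ∉ B ∨ (1 ≤ n ∧ (f⁻¹ ^ n) w ∈ B)) {S : α → α}
    (hS : ∀ z, S z = (f⁻¹ ^ returnTime f⁻¹ B h' (f z)) (f z)) :
    ∀ (j : ℕ) (w : α), w ∈ B → (f ^ j) w ∈ Function.periodicPts S := by
  have hoff : ∀ z, f z ∉ B → S z = f z := fun z hz => by
    rw [hS, returnTime_of_notMem h' hz]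
    rfl
  have hiter : ∀ (w : α) (j : ℕ), (∀ i, 1 ≤ i → i ≤ j → (f ^ i) w ∉ B) → S^[j] w = (f ^ j) w := by
    intro w j
    induction j with
    | zero => intro _; rfl
    | succ j ih =>
      intro hj
      have hlast := hj (j + 1) (by omega) le_rfl
      rw [pow_succ', Equiv.Perm.mul_apply] at hlast ⊢
      rw [Function.iterate_succ_apply', ih fun i h1 h2 => hj i h1 (by omega), hoff _ hlast]
  have hbase : ∀ w ∈ B, w ∈ Function.periodicPts S := by
    intro w hw
    obtain ⟨h1, h2, h3⟩ := returnTime_of_mem h hw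
    have hinv := returnTime_inv h h' w
    set r := returnTime f B h w with hr
    obtain ⟨s, hs⟩ := Nat.exists_eq_add_of_le' h1
    refine ⟨r, h1, ?_⟩
    show S^[r] w = w
    -- `S` climbs the column for `r - 1` steps; its last step would enter `B`, and is sent back `r`
    -- steps to `w`.
    rw [hs, Function.iterate_succ_apply', hiter w s fun i hi hi' => h3 i hi (by omega), hS,
      ← Equiv.Perm.mul_apply f, ← pow_succ', ← hs]
    exact hinv
  intro j
  induction j using Nat.strong_induction_on with
  | _ j ih =>
    intro w hw
    -- A later visit to `B` allows restarting from there with a shorter segment; otherwise the point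
    -- lies in the column of `w`.
    by_cases hj : ∃ i, 1 ≤ i ∧ i ≤ j ∧ (f ^ i) w ∈ B
    · obtain ⟨i, hi, hij, hB⟩ := hj
      have := ih (j - i) (by omega) _ hB
      rwa [← Equiv.Perm.mul_apply, ← pow_add, Nat.sub_add_cancel hij] at this
    · push Not at hj
      rw [← hiter w j hj]
      obtain ⟨r, hr, hp⟩ := hbase w hw
      exact ⟨r, hr, hp.apply_iterate j⟩

end Return

/-! ### Markers -/

section Marker

variable {α : Type*}

theorem zpow_mem_periodicPts (f : Equiv.Perm α) (i : ℤ) {z : α} :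
    (f ^ i) z ∈ Function.periodicPts f ↔ z ∈ Function.periodicPts f := by
  have key : ∀ (i : ℤ) (z : α), z ∈ Function.periodicPts f →
      (f ^ i) z ∈ Function.periodicPts f := by
    rintro i z ⟨n, hn, hz⟩
    refine ⟨n, hn, ?_⟩
    have hz' : (f ^ n) z = z := hz
    show (f ^ n) ((f ^ i) z) = (f ^ i) z
    rw [← Equiv.Perm.mul_apply, ← zpow_natCast f n, ← zpow_add, add_comm, zpow_add,
      Equiv.Perm.mul_apply, zpow_natCast f n, hz']
  refine ⟨fun h => ?_, key i z⟩
  have := key (-i) _ h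
  rwa [← Equiv.Perm.mul_apply, ← zpow_add, neg_add_cancel, zpow_zero] at this

/-- The greedy construction of a set with disjoint translates. -/
def markerStage (f : Equiv.Perm α) (N : ℕ) (C : ℕ → Set α) : ℕ → Set α
  | 0 => ∅
  | j + 1 => markerStage f N C j ∪
      (C j ∩ ⋂ i ∈ Finset.Icc (-(N : ℤ)) N, {z | (f ^ i) z ∉ markerStage f N C j})

theorem markerStage_mono (f : Equiv.Perm α) (N : ℕ) (C : ℕ → Set α) :
    Monotone (markerStage f N C) :=
  monotone_nat_of_le_succ fun _ => subset_union_left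

theorem markerStage_subset (f : Equiv.Perm α) (N : ℕ) {C : ℕ → Set α} {W : Set α}
    (hC : ∀ j, C j ⊆ W) (j : ℕ) : markerStage f N C j ⊆ W := by
  induction j with
  | zero => exact empty_subset _
  | succ j ih => exact union_subset ih (inter_subset_left.trans (hC j))

/-- A new point avoids the earlier stage at all times from `-N` to `N`, which excludes collisions in
either order; two new points are kept apart by the hypothesis on `C j`. -/
theorem markerStage_disjoint (f : Equiv.Perm α) (N : ℕ) {C : ℕ → Set α}
    (hC : ∀ j, ∀ z ∈ C j, ∀ i : ℕ, 1 ≤ i → i ≤ N → (f ^ i) z ∉ C j) (j : ℕ) :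
    ∀ z ∈ markerStage f N C j, ∀ i : ℕ, 1 ≤ i → i ≤ N → (f ^ i) z ∉ markerStage f N C j := by
  induction j with
  | zero => exact fun z hz => absurd hz (notMem_empty z)
  | succ j ih =>
    rintro z (hz | ⟨hzC, hz⟩) i h1 h2 (hi | ⟨hiC, hi⟩)
    · exact ih z hz i h1 h2 hi
    · simp only [mem_iInter, mem_ofPred_eq, Finset.mem_Icc] at hi
      refine hi (-i) ⟨by omega, by omega⟩ ?_
      rwa [← zpow_natCast, ← Equiv.Perm.mul_apply, ← zpow_add, neg_add_cancel, zpow_zero]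
    · simp only [mem_iInter, mem_ofPred_eq, Finset.mem_Icc] at hz
      refine hz i ⟨by omega, by omega⟩ ?_
      rwa [zpow_natCast]
    · exact hC j z hzC i h1 h2 hiC

theorem measurableSet_markerStage [MeasureSpace α] (T : MPEquiv α) (N : ℕ) {C : ℕ → Set α}
    (hC : ∀ j, MeasurableSet (C j)) (j : ℕ) : MeasurableSet (markerStage T.perm N C j) := by
  induction j with
  | zero => exact MeasurableSet.empty
  | succ j ih =>
    refine ih.union ((hC j).inter (Finset.measurableSet_biInter _ fun i _ => ?_))
    exact (T.measurable_zpow i ih).compl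

/-- A measurable set of aperiodic points contains a measurable subset whose first `N` translates
are disjoint and which every point of the set visits within time `N`. -/
theorem exists_marker [Nonempty α] [MeasureSpace α] [TopologicalSpace α] [SecondCountableTopology α]
    [T1Space α] [OpensMeasurableSpace α] (T : MPEquiv α) {W : Set α} (hW : MeasurableSet W)
    (hap : ∀ z ∈ W, z ∉ Function.periodicPts T.perm) (N : ℕ) :
    ∃ B ⊆ W, MeasurableSet B ∧
      (∀ z ∈ B, ∀ i : ℕ, 1 ≤ i → i ≤ N → (T.perm ^ i) z ∉ B) ∧
      ∀ z ∈ W, ∃ i : ℤ, -(N : ℤ) ≤ i ∧ i ≤ N ∧ (T.perm ^ i) z ∈ B := by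
  obtain ⟨U, hU⟩ : ∃ U : ℕ → Set α, TopologicalSpace.countableBasis α = range U :=
    (TopologicalSpace.countable_countableBasis α).exists_eq_range
      (by
        obtain ⟨V, hV, -⟩ := (TopologicalSpace.isBasis_countableBasis α).exists_subset_of_mem_open
          (mem_univ (Classical.arbitrary α)) isOpen_univ
        exact ⟨V, hV⟩)
  have hUb : TopologicalSpace.IsTopologicalBasis (range U) :=
    hU ▸ TopologicalSpace.isBasis_countableBasis α
  have hUm : ∀ j, MeasurableSet (U j) := fun j => (hUb.isOpen (mem_range_self j)).measurableSet
  -- Points of a basic open set that stay out of it for the next `N` steps. Aperiodicity makes these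
  -- countably many sets cover `W`: the next `N` iterates of `z` form a finite set missing `z`.
  let C : ℕ → Set α := fun j =>
    (W ∩ U j) ∩ ⋂ i ∈ Finset.Icc 1 N, {z | (T.perm ^ i) z ∉ U j}
  have hCm : ∀ j, MeasurableSet (C j) := fun j => by
    refine (hW.inter (hUm j)).inter (Finset.measurableSet_biInter _ fun i _ => ?_)
    have := T.measurable_zpow i (hUm j)
    rw [zpow_natCast] at this
    exact this.compl
  have hCW : ∀ j, C j ⊆ W := fun j => inter_subset_left.trans inter_subset_left
  have hCd : ∀ j, ∀ z ∈ C j, ∀ i : ℕ, 1 ≤ i → i ≤ N → (T.perm ^ i) z ∉ C j := by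
    rintro j z ⟨-, hz⟩ i h1 h2 ⟨⟨-, hi⟩, -⟩
    simp only [mem_iInter, mem_ofPred_eq, Finset.mem_Icc] at hz
    exact hz i ⟨h1, h2⟩ hi
  have hCc : ∀ z ∈ W, ∃ j, z ∈ C j := by
    intro z hz
    let F : Set α := (fun i : ℕ => (T.perm ^ i) z) '' (Finset.Icc 1 N : Finset ℕ)
    have hF : F.Finite := (Finset.finite_toSet _).image _
    have hzF : z ∈ Fᶜ := by
      rintro ⟨i, hi, hiz⟩
      rw [Finset.mem_coe, Finset.mem_Icc] at hi
      exact hap z hz ⟨i, hi.1, hiz⟩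
    obtain ⟨_, ⟨j, rfl⟩, hzj, hj⟩ := hUb.exists_subset_of_mem_open hzF hF.isClosed.isOpen_compl
    refine ⟨j, ⟨hz, hzj⟩, ?_⟩
    simp only [mem_iInter, mem_ofPred_eq]
    exact fun i hi hij => hj hij ⟨i, hi, rfl⟩
  refine ⟨⋃ j, markerStage T.perm N C j, iUnion_subset (markerStage_subset _ N hCW),
    MeasurableSet.iUnion (measurableSet_markerStage T N hCm), ?_, ?_⟩
  · intro z hz i h1 h2 hi
    obtain ⟨a, ha⟩ := mem_iUnion.1 hz
    obtain ⟨b, hb⟩ := mem_iUnion.1 hi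
    exact markerStage_disjoint T.perm N hCd (max a b) z
      (markerStage_mono _ N C (le_max_left a b) ha) i h1 h2
      (markerStage_mono _ N C (le_max_right a b) hb)
  · intro z hz
    obtain ⟨j, hj⟩ := hCc z hz
    by_cases h : ∃ i : ℤ, -(N : ℤ) ≤ i ∧ i ≤ N ∧ (T.perm ^ i) z ∈ markerStage T.perm N C j
    · obtain ⟨i, h1, h2, h3⟩ := h
      exact ⟨i, h1, h2, mem_iUnion.2 ⟨j, h3⟩⟩
    · push Not at h
      -- A point of `C j` with no marker nearby is itself added at the next stage.
      refine ⟨0, by omega, by omega, mem_iUnion.2 ⟨j + 1, Or.inr ⟨hj, ?_⟩⟩⟩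
      simp only [mem_iInter, mem_ofPred_eq, Finset.mem_Icc]
      exact fun i hi => h i hi.1 hi.2

/-- The `N + 1` preimages of `B` under `T^0, …, T^N` are disjoint and equally large. -/
theorem measure_marker_le [MeasureSpace α] [IsProbabilityMeasure (volume : Measure α)]
    (T : MPEquiv α) {B : Set α} (hB : MeasurableSet B) {N : ℕ}
    (hd : ∀ z ∈ B, ∀ i : ℕ, 1 ≤ i → i ≤ N → (T.perm ^ i) z ∉ B) :
    volume B ≤ ((N : ℝ≥0∞) + 1)⁻¹ := by
  have hm : ∀ i : ℕ, MeasurableSet ((T.perm ^ i : Equiv.Perm α) ⁻¹' B) := fun i => by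
    have := T.measurable_zpow i hB
    rwa [zpow_natCast] at this
  have hv : ∀ i : ℕ, volume ((T.perm ^ i : Equiv.Perm α) ⁻¹' B) = volume B := fun i => by
    have := (T.measurePreserving_zpow i).measure_preimage hB.nullMeasurableSet
    rwa [zpow_natCast] at this
  have key : ∀ i j : ℕ, i < j → j ≤ N → Disjoint ((T.perm ^ i : Equiv.Perm α) ⁻¹' B)
      ((T.perm ^ j : Equiv.Perm α) ⁻¹' B) := by
    intro i j hij hj
    refine Set.disjoint_left.2 fun z hi hj' => ?_
    refine hd _ hi (j - i) (by omega) (by omega) ?_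
    rwa [← Equiv.Perm.mul_apply, ← pow_add, Nat.sub_add_cancel hij.le]
  have hsum := sum_measure_le_measure_univ (μ := (volume : Measure α))
    (s := Finset.range (N + 1)) (t := fun i : ℕ => (T.perm ^ i : Equiv.Perm α) ⁻¹' B)
    (fun i _ => (hm i).nullMeasurableSet) (by
      intro i hi j hj hij
      simp only [Finset.coe_range, mem_Iio] at hi hj
      refine Disjoint.aedisjoint ?_
      rcases lt_or_gt_of_ne hij with h | h
      · exact key i j h (by omega)
      · exact (key j i h (by omega)).symm)
  simp only [hv, Finset.sum_const, Finset.card_range, nsmul_eq_mul, measure_univ] at hsum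
  rw [ENNReal.le_inv_iff_mul_le, mul_comm]
  exact_mod_cast hsum

theorem exists_zpow_mem_of_le {f : Equiv.Perm α} {W : Set α}
    (h : ∀ z ∈ W, ∃ n : ℕ, 1 ≤ n ∧ (f ^ n) z ∈ W) (M : ℕ) :
    ∀ z ∈ W, ∃ n : ℕ, M ≤ n ∧ (f ^ n) z ∈ W := by
  induction M with
  | zero => exact fun z hz => ⟨0, le_rfl, hz⟩
  | succ M ih =>
    intro z hz
    obtain ⟨n, hn, hnW⟩ := ih z hz
    obtain ⟨m, hm, hmW⟩ := h _ hnW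
    refine ⟨m + n, by omega, ?_⟩
    rwa [pow_add, Equiv.Perm.mul_apply]

/-- Closing up columns over a small subset of `W` makes all orbits through `W` periodic. -/
theorem exists_closing [MeasureSpace α] [IsProbabilityMeasure (volume : Measure α)]
    [TopologicalSpace α] [SecondCountableTopology α] [T1Space α] [OpensMeasurableSpace α]
    (T : MPEquiv α) {W : Set α} (hW : MeasurableSet W)
    (hap : ∀ z ∈ W, z ∉ Function.periodicPts T.perm)
    (hf : ∀ z ∈ W, ∃ n : ℕ, 1 ≤ n ∧ (T.perm ^ n) z ∈ W)
    (hb : ∀ z ∈ W, ∃ n : ℕ, 1 ≤ n ∧ (T.perm⁻¹ ^ n) z ∈ W) (N : ℕ) :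
    ∃ (k : α → ℤ) (S : MPEquiv α), Measurable k ∧ (∀ z, S z = (T.perm ^ k z) z) ∧
      volume {z | k z ≠ 1} ≤ ((N : ℝ≥0∞) + 1)⁻¹ ∧
      (∀ z, k z ≠ 1 → T z ∈ W ∧ S z ∈ W) ∧
      (∀ z, (∃ i : ℤ, (T.perm ^ i) z ∈ W) → z ∈ Function.periodicPts S) ∧
      ∀ z ∈ Function.periodicPts T.perm, z ∈ Function.periodicPts S := by
  have := nonempty_of_isProbabilityMeasure (volume : Measure α)
  obtain ⟨B, hBW, hB, hBd, hBc⟩ := exists_marker T hW hap N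
  set f := T.perm with hfT
  have hfB : ∀ w, ∃ n : ℕ, w ∉ B ∨ (1 ≤ n ∧ (f ^ n) w ∈ B) := by
    intro w
    by_cases hw : w ∈ B
    · obtain ⟨m, hm, hmW⟩ := exists_zpow_mem_of_le hf (N + 1) w (hBW hw)
      obtain ⟨i, hi, -, hiB⟩ := hBc _ hmW
      refine ⟨((m : ℤ) + i).toNat, Or.inr ⟨by omega, ?_⟩⟩
      rw [← zpow_natCast, Int.toNat_of_nonneg (by omega), add_comm, zpow_add,
        Equiv.Perm.mul_apply, zpow_natCast]
      exact hiB
    · exact ⟨0, Or.inl hw⟩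
  have hback : ∀ w ∈ W, ∃ n : ℕ, 1 ≤ n ∧ (f⁻¹ ^ n) w ∈ B := by
    intro w hw
    obtain ⟨m, hm, hmW⟩ := exists_zpow_mem_of_le hb (N + 1) w hw
    obtain ⟨i, -, hi, hiB⟩ := hBc _ hmW
    refine ⟨((m : ℤ) - i).toNat, by omega, ?_⟩
    rw [inv_pow, ← zpow_natCast, ← zpow_neg] at hmW hiB ⊢
    rwa [Int.toNat_of_nonneg (by omega), neg_sub, sub_eq_add_neg, zpow_add, Equiv.Perm.mul_apply]
  have hbB : ∀ w, ∃ n : ℕ, w ∉ B ∨ (1 ≤ n ∧ (f⁻¹ ^ n) w ∈ B) := by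
    intro w
    by_cases hw : w ∈ B
    · obtain ⟨n, hn⟩ := hback w (hBW hw)
      exact ⟨n, Or.inr hn⟩
    · exact ⟨0, Or.inl hw⟩
  let r : α → ℕ := returnTime f⁻¹ B hbB
  have hr : Measurable r := by
    classical
    refine measurable_find hbB fun n => ?_
    have h1 : MeasurableSet ((f ^ (-(n : ℤ)) : Equiv.Perm α) ⁻¹' B) := T.measurable_zpow _ hB
    rw [zpow_neg, zpow_natCast, ← inv_pow] at h1
    exact hB.compl.union ((MeasurableSet.const _).inter h1)
  -- One step forward, then, on landing in `B`, back to the previous visit. The exponent `1 - r (f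
  -- z)` is 1 exactly when `f z ∉ B`.
  let S₀ : α → α := fun z => (f⁻¹ ^ r (f z)) (f z)
  let k : α → ℤ := fun z => 1 - (r (f z) : ℤ)
  have hk : Measurable k := by
    have hfm : Measurable f := T.toEquiv.measurable
    exact (measurable_from_top (f := fun n : ℕ => (1 : ℤ) - n)).comp (hr.comp hfm)
  have hSk : ∀ z, S₀ z = (f ^ k z) z := by
    intro z
    show (f⁻¹ ^ r (f z)) (f z) = (f ^ (1 - (r (f z) : ℤ))) z
    rw [inv_pow, ← zpow_natCast, ← zpow_neg, sub_eq_neg_add, zpow_add, zpow_one,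
      Equiv.Perm.mul_apply]
  have hbij : Function.Bijective S₀ := by
    have hψ : Function.Bijective fun w => (f⁻¹ ^ r w) w := by
      refine Function.bijective_iff_has_inverse.2
        ⟨fun w => (f ^ returnTime f B hfB w) w, fun w => ?_, fun w => ?_⟩
      · exact returnTime_inv (f := f⁻¹) hbB hfB w
      · exact returnTime_inv hfB hbB w
    exact hψ.comp f.bijective
  obtain ⟨S, hS⟩ := exists_mpEquiv_of_zpow T hk hbij hSk
  have hk1 : ∀ z, k z ≠ 1 → f z ∈ B := by
    intro z hz
    by_contra hzB
    have : r (f z) = 0 := returnTime_of_notMem hbB hzB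
    exact hz (by simp [k, this])
  have hkW : ∀ z, k z ≠ 1 → T z ∈ W ∧ S z ∈ W := by
    intro z hz
    have hzB := hk1 z hz
    refine ⟨hBW hzB, ?_⟩
    rw [hS]
    exact hBW (returnTime_of_mem hbB hzB).2.1
  refine ⟨k, S, hk, fun z => (hS z).trans (hSk z), ?_, hkW, ?_, ?_⟩
  · calc volume {z | k z ≠ 1} ≤ volume (T ⁻¹' B) := measure_mono hk1
      _ = volume B := T.measurePreserving.measure_preimage hB.nullMeasurableSet
      _ ≤ _ := measure_marker_le T hB hBd
  · rintro z ⟨i, hi⟩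
    -- Going back at least `i` steps from the visit to `W`, and then on to `B`, puts `z` at a
    -- nonnegative time after a point of `B`.
    obtain ⟨m, hm, hmW⟩ := exists_zpow_mem_of_le hb i.toNat _ hi
    obtain ⟨n, -, hnB⟩ := hback _ hmW
    have := periodic_of_returnTime hfB hbB (S := S) (fun z => hS z)
      ((n : ℤ) + m - i).toNat _ hnB
    rw [inv_pow, inv_pow, ← zpow_natCast, ← zpow_natCast, ← zpow_natCast, ← zpow_neg, ← zpow_neg,
      Int.toNat_of_nonneg (by omega), ← Equiv.Perm.mul_apply, ← Equiv.Perm.mul_apply,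
      ← Equiv.Perm.mul_apply, ← zpow_add, ← zpow_add, ← zpow_add] at this
    have e : (n : ℤ) + m - i + -n + -m + i = 0 := by ring
    rwa [e, zpow_zero] at this
  · intro z hz
    have hT : ∀ n : ℕ, S^[n] z = (f ^ n) z := by
      intro n
      induction n with
      | zero => rfl
      | succ n ih =>
        rw [Function.iterate_succ_apply', ih, pow_succ', Equiv.Perm.mul_apply]
        -- `S` differs from `T` only where `T` enters `W`, which a periodic orbit never does.
        by_contra hne
        have h1 : k ((f ^ n) z) ≠ 1 := by
          intro h1
          apply hne
          rw [hS, hSk, h1, zpow_one]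
        have h2 := hap _ (hkW _ h1).1
        apply h2
        have := (zpow_mem_periodicPts f ((n : ℤ) + 1)).2 hz
        rwa [add_comm, zpow_add, zpow_one, zpow_natCast, Equiv.Perm.mul_apply] at this
    obtain ⟨n, hn, hnz⟩ := hz
    exact ⟨n, hn, (hT n).trans hnz⟩

end Marker

/-! ### Density of periodic extensions -/

section Density

/-- The points over whose `T`-orbit the map `T` lies exactly over `T'`. -/
def exactSet (T : MPEquiv Z) (T' : MPEquiv X) : Set Z :=
  ⋂ n : ℤ, {z | ((T.perm ^ n) z).1 = (T'.perm ^ n) z.1}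

theorem mem_exactSet {T : MPEquiv Z} {T' : MPEquiv X} {z : Z} :
    z ∈ exactSet T T' ↔ ∀ n : ℤ, ((T.perm ^ n) z).1 = (T'.perm ^ n) z.1 := by
  simp [exactSet]

theorem measurableSet_exactSet (T : MPEquiv Z) (T' : MPEquiv X) :
    MeasurableSet (exactSet T T') :=
  MeasurableSet.iInter fun n => measurableSet_eq_fun
    (measurable_fst.comp (T.measurable_zpow n)) ((T'.measurable_zpow n).comp measurable_fst)

theorem zpow_mem_exactSet {T : MPEquiv Z} {T' : MPEquiv X} (i : ℤ) {z : Z} :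
    (T.perm ^ i) z ∈ exactSet T T' ↔ z ∈ exactSet T T' := by
  have key : ∀ (i : ℤ) (z : Z), z ∈ exactSet T T' → (T.perm ^ i) z ∈ exactSet T T' := by
    intro i z hz
    rw [mem_exactSet] at hz ⊢
    intro n
    rw [hz i, ← Equiv.Perm.mul_apply, ← Equiv.Perm.mul_apply, ← zpow_add, ← zpow_add, hz]
  refine ⟨fun h => ?_, key i z⟩
  have := key (-i) _ h
  rwa [← Equiv.Perm.mul_apply, ← zpow_add, neg_add_cancel, zpow_zero] at this

/-- The extension relation is pulled back along the countably many powers of `T`, giving a conull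
invariant set where orbit arguments are pointwise. -/
theorem ae_mem_exactSet {T : MPEquiv Z} {T' : MPEquiv X} (h : Extends₀ T T') :
    ∀ᵐ z : Z, z ∈ exactSet T T' := by
  have h0 : ∀ᵐ z : Z, (T.perm z).1 = T'.perm z.1 := h
  have hpos : ∀ n : ℕ, ∀ᵐ z : Z, ((T.perm ^ n) z).1 = (T'.perm ^ n) z.1 := by
    intro n
    induction n with
    | zero => exact Eventually.of_forall fun _ => rfl
    | succ n ih =>
      have hq := (T.measurePreserving_zpow n).quasiMeasurePreserving.ae h0
      filter_upwards [ih, hq] with z a b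
      rw [zpow_natCast] at b
      rw [pow_succ', pow_succ', Equiv.Perm.mul_apply, Equiv.Perm.mul_apply, b, a]
  have hall : ∀ n : ℤ, ∀ᵐ z : Z, ((T.perm ^ n) z).1 = (T'.perm ^ n) z.1 := by
    intro n
    obtain ⟨m, rfl | rfl⟩ := n.eq_nat_or_neg
    · simpa only [zpow_natCast] using hpos m
    · filter_upwards [(T.measurePreserving_zpow (-m)).quasiMeasurePreserving.ae (hpos m)]
        with z hz
      rw [← zpow_natCast, ← zpow_natCast, ← Equiv.Perm.mul_apply, ← zpow_add, add_neg_cancel,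
        zpow_zero, Equiv.Perm.one_apply] at hz
      rw [hz, ← Equiv.Perm.mul_apply, ← zpow_add, neg_add_cancel, zpow_zero, Equiv.Perm.one_apply]
  filter_upwards [ae_all_iff.2 hall] with z hz
  exact mem_exactSet.2 hz

theorem measurableSet_periodicPts {α : Type*} [MeasureSpace α] [TopologicalSpace α] [T2Space α]
    [SecondCountableTopology α] [OpensMeasurableSpace α] (T : MPEquiv α) :
    MeasurableSet (Function.periodicPts T.perm) := by
  have e : (Function.periodicPts T.perm : Set α) =
      ⋃ n : ℕ, ⋃ _ : 0 < n, {z | (T.perm ^ (n : ℤ)) z = z} := by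
    ext z
    simp only [mem_iUnion, exists_prop, zpow_natCast]
    rfl
  rw [e]
  exact MeasurableSet.iUnion fun n => MeasurableSet.iUnion fun _ =>
    measurableSet_eq_fun (T.measurable_zpow n) measurable_id

/-- Changing `T'` to a map with only periodic points lifts to a change of the extension. -/
theorem exists_extends_periodic_factor {T : MPEquiv Z} {T' : MPEquiv X} (h : Extends₀ T T')
    (N : ℕ) : ∃ (S : MPEquiv Z) (S' : MPEquiv X), Extends₀ S S' ∧
      (∀ x, x ∈ Function.periodicPts S'.perm) ∧
      volume {z | S z ≠ T z} ≤ ((N : ℝ≥0∞) + 1)⁻¹ := by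
  classical
  have hW : MeasurableSet (Function.periodicPts T'.perm : Set X)ᶜ :=
    (measurableSet_periodicPts T').compl
  obtain ⟨k, S', hk, hS', hvol, -, hper, hper'⟩ := exists_closing T' hW (fun z hz => hz)
    (fun z hz => ⟨1, le_rfl, fun hc => hz ((zpow_mem_periodicPts T'.perm 1).1 (by simpa using hc))⟩)
    (fun z hz => ⟨1, le_rfl, fun hc =>
      hz ((zpow_mem_periodicPts T'.perm (-1)).1 (by simpa using hc))⟩) N
  let G := exactSet T T'
  have hG : MeasurableSet G := measurableSet_exactSet T T'
  -- The exponent of `S'` is lifted along the projection over `G`; elsewhere `T` is kept. As `G` is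
  -- invariant, bijectivity can be checked on `G` and its complement separately.
  let κ : Z → ℤ := fun z => if z ∈ G then k z.1 else 1
  have hκ : Measurable κ := Measurable.ite hG (hk.comp measurable_fst) measurable_const
  have hκG : ∀ z ∈ G, κ z = k z.1 := fun z hz => if_pos hz
  have hκG' : ∀ z ∉ G, κ z = 1 := fun z hz => if_neg hz
  have hfst : ∀ z ∈ G, ((T.perm ^ κ z) z).1 = S' z.1 := fun z hz => by
    rw [hκG z hz, mem_exactSet.1 hz, hS']
  have hbij : Function.Bijective fun z => (T.perm ^ κ z) z := by
    constructor
    · intro z w hzw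
      have hzw : (T.perm ^ κ z) z = (T.perm ^ κ w) w := hzw
      have hiff : z ∈ G ↔ w ∈ G := by
        rw [← zpow_mem_exactSet (κ z), ← zpow_mem_exactSet (z := w) (κ w), hzw]
      have hκe : κ z = κ w := by
        by_cases hz : z ∈ G
        · have h1 : S' z.1 = S' w.1 := by rw [← hfst z hz, ← hfst w (hiff.1 hz), hzw]
          rw [hκG z hz, hκG w (hiff.1 hz), S'.toEquiv.injective h1]
        · rw [hκG' z hz, hκG' w (mt hiff.2 hz)]
      rw [hκe] at hzw
      exact (T.perm ^ κ w).injective hzw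
    · intro w
      by_cases hw : w ∈ G
      · obtain ⟨x, hx⟩ := S'.toEquiv.surjective w.1
        have hx : (T'.perm ^ k x) x = w.1 := (hS' x).symm.trans hx
        have hz : (T.perm ^ (-k x)) w ∈ G := (zpow_mem_exactSet _).2 hw
        have hz1 : ((T.perm ^ (-k x)) w).1 = x := by
          rw [mem_exactSet.1 hw, ← hx, ← Equiv.Perm.mul_apply, ← zpow_add, neg_add_cancel,
            zpow_zero, Equiv.Perm.one_apply]
        refine ⟨(T.perm ^ (-k x)) w, ?_⟩
        show (T.perm ^ κ _) _ = w
        rw [hκG _ hz, hz1, ← Equiv.Perm.mul_apply, ← zpow_add, add_neg_cancel, zpow_zero,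
          Equiv.Perm.one_apply]
      · have hz : (T.perm ^ (-1 : ℤ)) w ∉ G := mt (zpow_mem_exactSet _).1 hw
        refine ⟨(T.perm ^ (-1 : ℤ)) w, ?_⟩
        show (T.perm ^ κ _) _ = w
        rw [hκG' _ hz, ← Equiv.Perm.mul_apply, ← zpow_add, add_neg_cancel, zpow_zero,
          Equiv.Perm.one_apply]
  obtain ⟨S, hS⟩ := exists_mpEquiv_of_zpow T hκ hbij fun _ => rfl
  refine ⟨S, S', ?_, fun x => ?_, ?_⟩
  · filter_upwards [ae_mem_exactSet h] with z hz
    rw [hS, hfst z hz]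
  · by_cases hx : x ∈ Function.periodicPts T'.perm
    · exact hper' x hx
    · exact hper x ⟨0, hx⟩
  · calc volume {z | S z ≠ T z} ≤ volume (Prod.fst ⁻¹' {x : X | k x ≠ 1} : Set Z) := by
          refine measure_mono fun z hz hk1 => hz ?_
          have : κ z = 1 := by
            by_cases hzG : z ∈ G
            · rw [hκG z hzG]; exact hk1
            · exact hκG' z hzG
          rw [hS, this, zpow_one]
          rfl
      _ = volume {x : X | k x ≠ 1} :=
          (measurePreserving_fst (μ := (volume : Measure X))
            (ν := (volume : Measure X))).measure_preimage
            (hk (measurableSet_singleton 1)).compl.nullMeasurableSet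
      _ ≤ _ := hvol

/-- Over a factor with only periodic points, an extension is close to an extension of the same
factor that is itself periodic almost everywhere. -/
theorem exists_periodic_extends {T : MPEquiv Z} {T' : MPEquiv X} (h : Extends₀ T T')
    (hT' : ∀ x, x ∈ Function.periodicPts T'.perm) (N : ℕ) :
    ∃ S : MPEquiv Z, Extends₀ S T' ∧ (∀ᵐ z : Z, z ∈ Function.periodicPts S) ∧
      volume {z | S z ≠ T z} ≤ ((N : ℝ≥0∞) + 1)⁻¹ := by
  -- A measurable transversal: the least point of each finite `T'`-orbit in `[0,1]`.
  let M : Set X := ⋂ n : ℤ, {x | x ≤ (T'.perm ^ n) x}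
  have memM : ∀ x, x ∈ M ↔ ∀ n : ℤ, x ≤ (T'.perm ^ n) x := fun x => by simp [M]
  have hM : MeasurableSet M := MeasurableSet.iInter fun n =>
    measurableSet_le measurable_id (T'.measurable_zpow n)
  let G := exactSet T T'
  let W : Set Z := (G ∩ (Function.periodicPts T.perm)ᶜ) ∩ Prod.fst ⁻¹' M
  have hW : MeasurableSet W := ((measurableSet_exactSet T T').inter
    (measurableSet_periodicPts T).compl).inter (measurable_fst hM)
  have hret : ∀ (i : ℤ) (z : Z), z ∈ W → (T'.perm ^ i) z.1 = z.1 → (T.perm ^ i) z ∈ W := by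
    rintro i z ⟨⟨hzG, hz⟩, hzM⟩ hi
    refine ⟨⟨(zpow_mem_exactSet i).2 hzG, mt (zpow_mem_periodicPts _ i).1 hz⟩, ?_⟩
    rw [mem_preimage, mem_exactSet.1 hzG, hi]
    exact hzM
  obtain ⟨k, S, hk, hS, hvol, hkW, hper, hper'⟩ := exists_closing T hW (fun z hz => hz.1.2)
    (fun z hz => by
      obtain ⟨n, hn, hnz⟩ := hT' z.1
      have hnz : (T'.perm ^ n) z.1 = z.1 := hnz
      refine ⟨n, hn, ?_⟩
      rw [← zpow_natCast] at hnz ⊢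
      exact hret n z hz hnz)
    (fun z hz => by
      obtain ⟨n, hn, hnz⟩ := hT' z.1
      have hnz : (T'.perm ^ n) z.1 = z.1 := hnz
      refine ⟨n, hn, ?_⟩
      rw [inv_pow, ← zpow_natCast, ← zpow_neg]
      refine hret (-n) z hz ?_
      rw [zpow_neg, zpow_natCast, Equiv.Perm.inv_eq_iff_eq, hnz]) N
  refine ⟨S, ?_, ?_, ?_⟩
  · filter_upwards [ae_mem_exactSet h] with z hz
    have h1 : (T.perm z).1 = T'.perm z.1 := by simpa using mem_exactSet.1 hz 1
    by_cases hkz : k z = 1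
    · rw [hS, hkz, zpow_one]
      exact h1
    · obtain ⟨⟨-, hTM⟩, ⟨-, hSM⟩⟩ := hkW z hkz
      have h2 : (S z).1 = (T'.perm ^ k z) z.1 := by rw [hS, mem_exactSet.1 hz]
      rw [mem_preimage, ← MPEquiv.perm_apply, h1] at hTM
      rw [mem_preimage, h2] at hSM
      rw [h2]
      -- `T z` and `S z` both lie over the least point of the same `T'`-orbit; comparing each with
      -- the other yields equality.
      have e1 : T'.perm z.1 = (T'.perm ^ (1 - k z)) ((T'.perm ^ k z) z.1) := by
        rw [← Equiv.Perm.mul_apply, ← zpow_add, sub_add_cancel, zpow_one]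
      have e2 : (T'.perm ^ k z) z.1 = (T'.perm ^ (k z - 1)) (T'.perm z.1) := by
        rw [← Equiv.Perm.mul_apply, ← zpow_add_one, sub_add_cancel]
      refine le_antisymm ?_ ?_
      · change _ ≤ T'.perm z.1
        rw [e1]
        exact (memM _).1 hSM _
      · change T'.perm z.1 ≤ _
        rw [e2]
        exact (memM _).1 hTM _
  · filter_upwards [ae_mem_exactSet h] with z hz
    by_cases hzp : z ∈ Function.periodicPts T.perm
    · exact hper' z hzp
    · obtain ⟨p, hp, hpz⟩ := hT' z.1
      have hpz : (T'.perm ^ p) z.1 = z.1 := hpz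
      -- A minimum over one period is a minimum over the whole orbit, by reducing exponents modulo
      -- `p`.
      obtain ⟨i, -, hi⟩ := Finset.exists_min_image (Finset.range p)
        (fun i : ℕ => (T'.perm ^ i) z.1) ⟨0, Finset.mem_range.2 hp⟩
      refine hper z ⟨i, ⟨(zpow_mem_exactSet _).2 hz, mt (zpow_mem_periodicPts _ _).1 hzp⟩, ?_⟩
      rw [mem_preimage, mem_exactSet.1 hz, memM]
      intro n
      have hmod : ∀ m : ℤ, (T'.perm ^ m) z.1 = (T'.perm ^ (m % p).toNat) z.1 := by
        intro m
        have hq : ∀ q : ℤ, ((T'.perm ^ p) ^ q) z.1 = z.1 := fun q =>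
          Equiv.Perm.zpow_apply_eq_self_of_apply_eq_self hpz q
        conv_lhs => rw [← Int.emod_add_mul_ediv m p, zpow_add, zpow_mul, zpow_natCast,
          Equiv.Perm.mul_apply, hq]
        rw [← zpow_natCast, Int.toNat_of_nonneg (Int.emod_nonneg _ (by omega))]
      rw [← Equiv.Perm.mul_apply, ← zpow_add, hmod (n + i), zpow_natCast]
      refine hi _ (Finset.mem_range.2 ?_)
      have h1 := Int.emod_nonneg (n + i) (b := (p : ℤ)) (by omega)
      have h2 := Int.emod_lt_of_pos (n + i) (b := (p : ℤ)) (by omega)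
      omega
  · refine (measure_mono fun z (hz : S z ≠ T z) (hk1 : k z = 1) => hz ?_).trans hvol
    rw [hS, hk1, zpow_one]
    rfl

theorem exists_periodic_near {T : MPEquiv Z} {T' : MPEquiv X} (h : Extends₀ T T') (N : ℕ) :
    ∃ (S : MPEquiv Z) (S' : MPEquiv X), Extends₀ S S' ∧
      (∀ᵐ z : Z, z ∈ Function.periodicPts S) ∧
      volume {z | S z ≠ T z} ≤ 2 * ((N : ℝ≥0∞) + 1)⁻¹ := by
  obtain ⟨T₁, T₁', h1, hp, hv1⟩ := exists_extends_periodic_factor h N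
  obtain ⟨S, hS, hSp, hv2⟩ := exists_periodic_extends h1 hp N
  refine ⟨S, T₁', hS, hSp, ?_⟩
  have hsub : {z | S z ≠ T z} ⊆ {z | S z ≠ T₁ z} ∪ {z | T₁ z ≠ T z} := by
    intro z hz
    by_cases h : S z = T₁ z
    · exact Or.inr fun h' => hz (h.trans h')
    · exact Or.inl h
  calc volume {z | S z ≠ T z} ≤ _ := measure_mono hsub
    _ ≤ _ := measure_union_le _ _
    _ ≤ _ := add_le_add hv2 hv1
    _ = _ := (two_mul _).symm

end Density

/-! ### The weak topology -/

section WeakTopology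

variable {α : Type*} [MeasureSpace α]

theorem MPEquiv.coe_pow (T : MPEquiv α) (n : ℕ) : T^[n] = (T.perm ^ n : Equiv.Perm α) := rfl

theorem MPEquiv.measurePreserving_iterate (T : MPEquiv α) (n : ℕ) :
    MeasurePreserving T^[n] (volume : Measure α) volume :=
  T.measurePreserving.iterate n

theorem MPEquiv.injective_iterate (T : MPEquiv α) (n : ℕ) : Function.Injective T^[n] :=
  T.toEquiv.injective.iterate n

theorem MPEquiv.measurableSet_image_iterate (T : MPEquiv α) (n : ℕ) {E : Set α}
    (hE : MeasurableSet E) : MeasurableSet (T^[n] '' E) := by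
  rw [T.coe_pow, ← zpow_natCast, T.image_zpow]
  exact T.measurable_zpow _ hE

theorem MPEquiv.measure_image_iterate (T : MPEquiv α) (n : ℕ) {E : Set α}
    (hE : MeasurableSet E) : volume (T^[n] '' E) = volume E := by
  rw [T.coe_pow, ← zpow_natCast, T.image_zpow]
  exact (T.measurePreserving_zpow _).measure_preimage hE.nullMeasurableSet

theorem MPEquiv.measure_image_iterate_inter (T : MPEquiv α) (n : ℕ) {E : Set α}
    (hE : MeasurableSet E) : volume ((T^[n] '' E) ∩ E) = volume (T^[n] ⁻¹' E ∩ E) := by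
  rw [← (T.measurePreserving_iterate n).measure_preimage
    ((T.measurableSet_image_iterate n hE).inter hE).nullMeasurableSet, preimage_inter,
    preimage_image_eq _ (T.injective_iterate n), inter_comm]

theorem MPEquiv.measure_image (T : MPEquiv α) (E : Set α) : volume (T '' E) = volume E := by
  conv_rhs => rw [← preimage_image_eq E T.toEquiv.injective]
  exact (T.measurePreserving.measure_preimage_equiv _).symm

/-- Taking iterates is continuous for the weak topology. -/
theorem eventually_measure_image_iterate_symmDiff_lt (T : MPEquiv α) (n : ℕ) :
    ∀ (E : Set α) (ε : ℝ), MeasurableSet E → 0 < ε → ∀ᶠ Q in nhds (X := Transf α) ⟦T⟧,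
      ∀ S : MPEquiv α, (⟦S⟧ : Transf α) = Q →
        volume ((S^[n] '' E) ∆ (T^[n] '' E)) < ENNReal.ofReal ε := by
  induction n with
  | zero =>
    intro E ε _ hε
    refine Eventually.of_forall fun Q S _ => ?_
    simpa using hε
  | succ n ih =>
    intro E ε hE hε
    have hone : ∀ᶠ Q in nhds (X := Transf α) ⟦T⟧, imageDist E ⟦T⟧ Q < ENNReal.ofReal (ε / 2) := by
      refine IsOpen.mem_nhds (TopologicalSpace.isOpen_generateFrom_of_mem
        ⟨⟦T⟧, E, ε / 2, hE, half_pos hε, rfl⟩) ?_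
      show volume ((T '' E) ∆ (T '' E)) < ENNReal.ofReal (ε / 2)
      simpa using hε
    have hTE : MeasurableSet (T '' E) := T.toEquiv.measurableSet_image.2 hE
    filter_upwards [hone, ih (T '' E) (ε / 2) hTE (half_pos hε)] with Q h1 h2 S hS
    have hSE : MeasurableSet (S '' E) := S.toEquiv.measurableSet_image.2 hE
    subst hS
    have h1 : volume ((T '' E) ∆ (S '' E)) < ENNReal.ofReal (ε / 2) := h1
    rw [Function.iterate_succ, Function.iterate_succ, image_comp, image_comp]
    -- The intermediate set is `Sⁿ(TE)`: since `Sⁿ` preserves measure, the first error is that of a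
    -- single step, and the second is the induction hypothesis for `TE`.
    calc volume ((S^[n] '' (S '' E)) ∆ (T^[n] '' (T '' E)))
        ≤ volume ((S^[n] '' (S '' E)) ∆ (S^[n] '' (T '' E))) +
          volume ((S^[n] '' (T '' E)) ∆ (T^[n] '' (T '' E))) := measure_symmDiff_le _ _ _
      _ = volume ((T '' E) ∆ (S '' E)) +
          volume ((S^[n] '' (T '' E)) ∆ (T^[n] '' (T '' E))) := by
          rw [← image_symmDiff (S.injective_iterate n),
            S.measure_image_iterate n (hSE.symmDiff hTE), symmDiff_comm]
      _ < ENNReal.ofReal (ε / 2) + ENNReal.ofReal (ε / 2) := ENNReal.add_lt_add h1 (h2 S rfl)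
      _ = ENNReal.ofReal ε := by
          rw [← ENNReal.ofReal_add (half_pos hε).le (half_pos hε).le, add_halves]

/-- The transformations one of whose late iterates returns a large part of `E` to `E`. -/
def recurrentSet (E : Set α) (c : ℝ≥0∞) (n : ℕ) : Set (Transf α) :=
  {Q | ∃ S : MPEquiv α, (⟦S⟧ : Transf α) = Q ∧ ∃ k, n ≤ k ∧ c < volume ((S^[k] '' E) ∩ E)}

/-- The strict inequality leaves a slack `r`, and for the fixed time `k` a weakly small change of
`T` moves `T^k E` by less than `r`. -/
theorem isOpen_recurrentSet {E : Set α} (hE : MeasurableSet E) (c : ℝ≥0∞) (n : ℕ) :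
    IsOpen (recurrentSet E c n) := by
  rw [isOpen_iff_mem_nhds]
  rintro _ ⟨T, rfl, k, hk, hc⟩
  obtain ⟨r, hr, hrc⟩ := ENNReal.lt_iff_exists_add_pos_lt.1 hc
  filter_upwards [eventually_measure_image_iterate_symmDiff_lt T k E r hE hr] with Q hQ
  obtain ⟨S, rfl⟩ := Quotient.exists_rep Q
  refine ⟨S, rfl, k, hk, ?_⟩
  have hS := hQ S rfl
  rw [ENNReal.ofReal_coe_nnreal] at hS
  by_contra! hle
  refine absurd hrc (not_lt.2 ?_)
  have hsub : (T^[k] '' E) ∩ E ⊆ ((S^[k] '' E) ∩ E) ∪ ((S^[k] '' E) ∆ (T^[k] '' E)) := by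
    rintro z ⟨hz, hzE⟩
    by_cases hzS : z ∈ S^[k] '' E
    · exact Or.inl ⟨hzS, hzE⟩
    · exact Or.inr (Or.inr ⟨hz, hzS⟩)
  exact ((measure_mono hsub).trans (measure_union_le _ _)).trans (add_le_add hle hS.le)

theorem measure_image_symmDiff_le (S T : MPEquiv α) (E : Set α) :
    volume ((T '' E) ∆ (S '' E)) ≤ volume {z | S z ≠ T z} + volume {z | S z ≠ T z} := by
  have hsub : (T '' E) ∆ (S '' E) ⊆ (T '' {z | S z ≠ T z}) ∪ (S '' {z | S z ≠ T z}) := by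
    rintro _ (⟨⟨z, hz, rfl⟩, hn⟩ | ⟨⟨z, hz, rfl⟩, hn⟩)
    · exact Or.inl ⟨z, fun he => hn ⟨z, hz, he⟩, rfl⟩
    · exact Or.inr ⟨z, fun he => hn ⟨z, hz, he.symm⟩, rfl⟩
  refine ((measure_mono hsub).trans (measure_union_le _ _)).trans ?_
  rw [T.measure_image, S.measure_image]

/-- Uniform convergence implies weak convergence. -/
theorem tendsto_of_measure_ne_tendsto {T : MPEquiv α} {S : ℕ → MPEquiv α}
    (h : Tendsto (fun j => volume {z | S j z ≠ T z}) atTop (𝓝 0)) :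
    Tendsto (fun j => (⟦S j⟧ : Transf α)) atTop (nhds (X := Transf α) ⟦T⟧) := by
  refine TopologicalSpace.tendsto_nhds_generateFrom_iff.2 ?_
  rintro _ ⟨U, E, ε, hE, hε, rfl⟩ hT
  obtain ⟨U, rfl⟩ := Quotient.exists_rep U
  have hT : volume ((U '' E) ∆ (T '' E)) < ENNReal.ofReal ε := hT
  obtain ⟨r, hr, hrc⟩ := ENNReal.lt_iff_exists_add_pos_lt.1 hT
  have h2 := h.add h
  rw [add_zero] at h2
  filter_upwards [h2.eventually (gt_mem_nhds (ENNReal.coe_pos.2 hr))] with j hj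
  show volume ((U '' E) ∆ (S j '' E)) < ENNReal.ofReal ε
  calc volume ((U '' E) ∆ (S j '' E))
      ≤ volume ((U '' E) ∆ (T '' E)) + volume ((T '' E) ∆ (S j '' E)) := measure_symmDiff_le _ _ _
    _ ≤ volume ((U '' E) ∆ (T '' E)) + r := by
        gcongr
        exact (measure_image_symmDiff_le (S j) T E).trans hj.le
    _ < ENNReal.ofReal ε := hrc

/-- An almost everywhere periodic transformation has late iterates returning almost all
of `E` to `E`. -/
theorem mem_recurrentSet_of_periodic {S : MPEquiv α}
    (h : ∀ᵐ z : α, z ∈ Function.periodicPts S) {E : Set α} {c : ℝ≥0∞} (hc : c < volume E)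
    (n : ℕ) : (⟦S⟧ : Transf α) ∈ recurrentSet E c n := by
  -- Factorial times make these sets increase, and every period eventually divides `m!`, so they
  -- exhaust `E` up to a null set.
  let A : ℕ → Set α := fun m => {z | z ∈ E ∧ S^[m.factorial] z = z}
  have hA : Monotone A := by
    rintro a b hab z ⟨hzE, hz⟩
    have hz : Function.IsPeriodicPt S a.factorial z := hz
    exact ⟨hzE, hz.trans_dvd (Nat.factorial_dvd_factorial hab)⟩
  have hU : volume (⋃ m, A m) = volume E := by
    refine measure_congr ?_
    filter_upwards [h] with z ⟨p, hp, hz⟩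
    refine propext ⟨fun hzA => ?_, fun hzE => ?_⟩
    · obtain ⟨m, hm⟩ := mem_iUnion.1 hzA
      exact hm.1
    · exact mem_iUnion.2 ⟨p, hzE, hz.trans_dvd (Nat.dvd_factorial hp le_rfl)⟩
  have hlim := tendsto_measure_iUnion_atTop (μ := (volume : Measure α)) hA
  rw [hU] at hlim
  obtain ⟨m, hm, hmn⟩ := ((hlim.eventually (lt_mem_nhds hc)).and (eventually_ge_atTop n)).exists
  refine ⟨S, rfl, m.factorial, hmn.trans (Nat.self_le_factorial m),
    hm.trans_le (measure_mono ?_)⟩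
  rintro z ⟨hzE, hz⟩
  exact ⟨⟨z, hzE, hz⟩, hzE⟩

end WeakTopology

/-! ### Mixing -/

section Mixing

/-- The lower half of the square. -/
def lowerHalf : Set Z := Prod.snd ⁻¹' Iic (⟨1 / 2, by norm_num, by norm_num⟩ : X)

theorem measurableSet_lowerHalf : MeasurableSet lowerHalf := measurable_snd measurableSet_Iic

theorem volume_real_Iic_half :
    (volume : Measure X).real (Iic (⟨1 / 2, by norm_num, by norm_num⟩ : X)) = 1 / 2 := by
  rw [Measure.real, unitInterval.volume_Iic, ENNReal.toReal_ofReal (by norm_num)]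

theorem volume_lowerHalf : volume lowerHalf = ENNReal.ofReal (1 / 2) := by
  have h := (measurePreserving_snd (μ := (volume : Measure X))
    (ν := (volume : Measure X))).measure_preimage (s := Iic (⟨1 / 2, by norm_num, by norm_num⟩ : X))
      measurableSet_Iic.nullMeasurableSet
  rw [unitInterval.volume_Iic] at h
  exact h

/-- Every fibre meets the set in measure 1/2, so the product term in the mixing relation is the
constant 1/4 whatever `T'` is. -/
theorem relExp_indicator_lowerHalf {E : Type*} [NormedAddCommGroup E] [NormedSpace ℝ E]
    [CompleteSpace E] (c : E) (x : X) :
    relExp (lowerHalf.indicator fun _ => c) x = (1 / 2 : ℝ) • c := by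
  have h : (fun y : X => lowerHalf.indicator (fun _ => c) (x, y)) =
      (Iic (⟨1 / 2, by norm_num, by norm_num⟩ : X)).indicator fun _ => c := rfl
  rw [relExp, h, integral_indicator_const _ measurableSet_Iic, volume_real_Iic_half]

theorem memRelL2_indicator_lowerHalf :
    MemRelL2 (lowerHalf.indicator fun _ => (1 : ℂ)) := by
  refine ⟨memLp_indicator_const 2 measurableSet_lowerHalf 1 (Or.inr (measure_ne_top _ _)), ?_⟩
  have h : (fun z : Z => ‖lowerHalf.indicator (fun _ => (1 : ℂ)) z‖ ^ 2) =
      lowerHalf.indicator fun _ => (1 : ℝ) := by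
    ext z
    by_cases hz : z ∈ lowerHalf <;> simp [hz]
  simp only [h, relExp_indicator_lowerHalf]
  exact memLp_const _

theorem StronglyMixing₀.eventually_measure_le {T : MPEquiv Z} {T' : MPEquiv X}
    (h : StronglyMixing₀ T T') :
    ∀ᶠ n : ℕ in atTop, volume ((T^[n] '' lowerHalf) ∩ lowerHalf) ≤ ENNReal.ofReal (2 / 5) := by
  have hlim := h _ _ memRelL2_indicator_lowerHalf memRelL2_indicator_lowerHalf
  -- Here `3/20 = 2/5 - 1/4`; any threshold strictly between 1/4 and 1/2 could replace 2/5.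
  filter_upwards [hlim.eventually (gt_mem_nhds (ENNReal.ofReal_pos.2
    (by norm_num : (0 : ℝ) < 3 / 20)))] with n hn
  have hconj : (fun z : Z => starRingEnd ℂ (lowerHalf.indicator (fun _ => (1 : ℂ)) z)) =
      lowerHalf.indicator fun _ => (1 : ℂ) := by
    ext z
    by_cases hz : z ∈ lowerHalf <;> simp [hz]
  have hE : MeasurableSet (T^[n] ⁻¹' lowerHalf ∩ lowerHalf) :=
    ((T.measurePreserving_iterate n).measurable measurableSet_lowerHalf).inter
      measurableSet_lowerHalf
  have hprod : (fun z : Z => lowerHalf.indicator (fun _ => (1 : ℂ)) (T^[n] z) *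
      starRingEnd ℂ (lowerHalf.indicator (fun _ => (1 : ℂ)) z)) =
      (T^[n] ⁻¹' lowerHalf ∩ lowerHalf).indicator fun _ => (1 : ℂ) := by
    ext z
    by_cases hz : z ∈ lowerHalf <;> by_cases hz' : T^[n] z ∈ lowerHalf <;>
      simp [hz, hz', indicator]
  simp only [hprod, hconj, relExp_indicator_lowerHalf] at hn
  set F : Set Z := T^[n] ⁻¹' lowerHalf ∩ lowerHalf with hF
  have hint : Integrable (F.indicator fun _ => (1 : ℂ)) (volume : Measure Z) :=
    (integrable_const _).indicator hE
  have hrel : Integrable (relExp (F.indicator fun _ => (1 : ℂ))) (volume : Measure X) :=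
    hint.integral_prod_left
  have hrelint : ∫ x : X, relExp (F.indicator fun _ => (1 : ℂ)) x =
      ((volume : Measure Z).real F : ℂ) := by
    have h1 := integral_prod _ hint
    rw [← Measure.volume_eq_prod, integral_indicator_const _ hE] at h1
    rw [show (∫ x : X, relExp (F.indicator fun _ => (1 : ℂ)) x) = _ from h1.symm]
    simp
  set φ : X → ℂ := fun x => relExp (F.indicator fun _ => (1 : ℂ)) x -
    (1 / 2 : ℝ) • (1 : ℂ) * (1 / 2 : ℝ) • (1 : ℂ) with hφ
  have hφint : Integrable φ := hrel.sub (integrable_const _)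
  have hφval : ∫ x, φ x = (((volume : Measure Z).real F - 1 / 4 : ℝ) : ℂ) := by
    rw [hφ, integral_sub hrel (integrable_const _), hrelint]
    simp
    norm_num
  -- On a probability space the `L¹` norm is at most the `L²` norm, so the mean of the mixing defect
  -- is small as well.
  have hle : ‖∫ x, φ x‖ₑ < ENNReal.ofReal (3 / 20) :=
    calc ‖∫ x, φ x‖ₑ ≤ ∫⁻ x, ‖φ x‖ₑ := enorm_integral_le_lintegral_enorm _
      _ = eLpNorm φ 1 volume := eLpNorm_one_eq_lintegral_enorm.symm
      _ ≤ eLpNorm φ 2 volume :=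
        eLpNorm_le_eLpNorm_of_exponent_le (by norm_num) hφint.aestronglyMeasurable
      _ < _ := hn
  rw [hφval, ← ofReal_norm, ENNReal.ofReal_lt_ofReal_iff (by norm_num),
    Complex.norm_real, Real.norm_eq_abs] at hle
  have hreal : (volume : Measure Z).real F ≤ 2 / 5 := by
    have := (abs_lt.1 hle).2
    linarith
  rw [T.measure_image_iterate_inter n measurableSet_lowerHalf]
  exact (ENNReal.le_ofReal_iff_toReal_le (measure_ne_top _ _) (by norm_num)).2 hreal

theorem dense_preimage_recurrentSet (n : ℕ) :
    Dense ((↑) ⁻¹' recurrentSet lowerHalf (ENNReal.ofReal (2 / 5)) n : Set GX) := by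
  rintro ⟨T, T', hT⟩
  obtain ⟨T, rfl⟩ := Quotient.exists_rep T
  obtain ⟨T', rfl⟩ := Quotient.exists_rep T'
  have hT₀ : Extends₀ T T' := hT
  choose S S' hS hSp hvol using exists_periodic_near hT₀
  have hlim : Tendsto (fun j => volume {z | S j z ≠ T z}) atTop (𝓝 0) := by
    have h1 : Tendsto (fun j : ℕ => ((j : ℝ≥0∞) + 1)⁻¹) atTop (𝓝 0) := by
      have := ENNReal.tendsto_inv_nat_nhds_zero.comp (tendsto_add_atTop_nat 1)
      refine this.congr fun j => ?_
      simp
    have h2 := ENNReal.Tendsto.const_mul (a := 2) h1 (Or.inr (by norm_num))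
    rw [mul_zero] at h2
    exact tendsto_of_tendsto_of_tendsto_of_le_of_le tendsto_const_nhds h2 (fun _ => zero_le) hvol
  refine mem_closure_of_tendsto (f := fun j => (⟨⟦S j⟧, ⟦S' j⟧, hS j⟩ : GX)) (b := atTop)
    (tendsto_subtype_rng.2 (tendsto_of_measure_ne_tendsto hlim)) (Eventually.of_forall fun j => ?_)
  refine mem_recurrentSet_of_periodic (hSp j) ?_ n
  rw [volume_lowerHalf]
  exact (ENNReal.ofReal_lt_ofReal_iff (by norm_num)).2 (by norm_num)

theorem exists_notMem_recurrentSet_of_mem_SX {T : GX} (hT : T ∈ SX) :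
    ∃ n, (T : Transf Z) ∉ recurrentSet lowerHalf (ENNReal.ofReal (2 / 5)) n := by
  obtain ⟨T', -, hmix⟩ := hT
  obtain ⟨T', rfl⟩ := Quotient.exists_rep T'
  by_contra! hall
  obtain ⟨S, hST, -⟩ := hall 0
  rw [← hST] at hmix
  have hmix₀ : StronglyMixing₀ S T' := hmix
  obtain ⟨n, hn⟩ := eventually_atTop.1 hmix₀.eventually_measure_le
  obtain ⟨S₁, hS₁, k, hk, hlt⟩ := hall n
  -- The late return may be witnessed by another representative, but the measure involved depends
  -- only on the class.
  have hSS : S₁ ≈ S := Quotient.exact (hS₁.trans hST.symm)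
  refine absurd hlt (not_lt.2 (le_trans (le_of_eq ?_) (hn k hk)))
  rw [S₁.measure_image_iterate_inter k measurableSet_lowerHalf,
    S.measure_image_iterate_inter k measurableSet_lowerHalf]
  refine measure_congr ?_
  filter_upwards [iterate_ae_eq hSS k] with z hz
  show (S₁^[k] z ∈ lowerHalf ∧ z ∈ lowerHalf) = (S^[k] z ∈ lowerHalf ∧ z ∈ lowerHalf)
  rw [hz]

end Mixing

end MixExt

theorem mainTheorem2 : IsMeagre MixExt.SX := by
  have h : ∀ n : ℕ, ((↑) ⁻¹' MixExt.recurrentSet MixExt.lowerHalf (ENNReal.ofReal (2 / 5)) n :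
      Set MixExt.GX) ∈ residual MixExt.GX := fun n =>
    residual_of_dense_open ((MixExt.isOpen_recurrentSet MixExt.measurableSet_lowerHalf _ n).preimage
      continuous_subtype_val) (MixExt.dense_preimage_recurrentSet n)
  refine mem_of_superset (countable_iInter_mem.2 h) fun T hT hSX => ?_
  obtain ⟨n, hn⟩ := MixExt.exists_notMem_recurrentSet_of_mem_SX hSX
  exact hn (mem_iInter.1 hT n)
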